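/- Conventions. Topological spaces carry no separation axioms. A cellular family in a space $X$ is a family of pairwise disjoint nonempty open subsets of $X$, and the Souslin number $S(X)$ is the least cardinal $\lambda$ (possibly finite) such that no cellular family $\mathcal A$ in $X$ satisfies $|\mathcal A|=\lambda$. For a family $\{X_i:i\in I\}$ of spaces and an infinite cardinal $\kappa$, $(X_I)_\kappa$ denotes the product $\prod_{i\in I}X_i$ with the $\kappa$-box topology, which has as a base the sets $\prod_{i\in I}U_i$ with each $U_i$ open in $X_i$ and $|\{i\in I:U_i\neq X_i\}|<\kappa$. For a cardinal $\alpha$, $\alpha^+$ is the least cardinal greater than $\alpha$ (so $\alpha^+=\alpha+1$ if $\alpha$ is finite), and for $\alpha\ge2$ and $\kappa\geq\omega$, $\alpha^{<\kappa}:=\sum_{\lambda<\kappa}\alpha^\lambda=\sup_{\lambda<\kappa}\alpha^\lambda$, where $\lambda$ ranges over cardinals. Theorem 4.36. Let $\alpha\ge2$ and $\kappa\ge\omega$ be cardinals and let $\{X_i:i\in I\}$ be a family of nonempty topological spaces such that $S(X_i)\le\alpha^+$ for each $i\in I$. (a) If $\alpha^+\ge\kappa$, then $S((X_I)_\kappa)\le(2^\alpha)^+$.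 (b) If $\alpha^+\le\kappa$, then $S((X_I)_\kappa)\le((\alpha^{<\kappa})^{<\kappa})^+$. -/

import Mathlib

open scoped Cardinal

universe u

/-- A cellular family in a space `X`: a set of pairwise disjoint nonempty open subsets of `X`. -/
structure IsCellular {X : Type u} [TopologicalSpace X] (A : Set (Set X)) : Prop where
  isOpen : ∀ U ∈ A, IsOpen U
  nonempty : ∀ U ∈ A, U.Nonempty
  pairwiseDisjoint : A.PairwiseDisjoint id

/-- The Souslin number `S(X)`: the least cardinal `μ` such that no cellular family in `X` has
cardinality exactly `μ`. Finite values are allowed. -/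
noncomputable def souslinNumber (X : Type u) [TopologicalSpace X] : Cardinal.{u} :=
  sInf {μ : Cardinal.{u} | ¬ ∃ A : Set (Set X), IsCellular A ∧ #A = μ}

/-- The minimum defining `S(X)` is taken over a nonempty set of cardinals, so it is attained. -/
theorem souslinNumber_set_nonempty (X : Type u) [TopologicalSpace X] :
    {μ : Cardinal.{u} | ¬ ∃ A : Set (Set X), IsCellular A ∧ #A = μ}.Nonempty := by
  refine ⟨Order.succ #(Set X), ?_⟩
  rintro ⟨A, -, hA⟩
  have h : #A ≤ #(Set X) := Cardinal.mk_set_le A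
  rw [hA] at h
  exact absurd (Order.lt_succ #(Set X)) (not_lt.mpr h)

/-- The canonical open sets of the `κ`-box topology: products `∏ U i` of open sets `U i ⊆ X i`
for which fewer than `κ` indices `i` satisfy `U i ≠ X i`. -/
def canonicalOpenSets (κ : Cardinal.{u}) {I : Type u} (X : I → Type u)
    [∀ i, TopologicalSpace (X i)] : Set (Set (∀ i, X i)) :=
  {B | ∃ U : ∀ i, Set (X i), (∀ i, IsOpen (U i)) ∧ #{i : I | U i ≠ Set.univ} < κ ∧
    B = Set.univ.pi U}

/-- The space `(X_I)_κ`: the full product `∏ X i`, carrying the `κ`-box topology. -/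
def BoxProduct (_κ : Cardinal.{u}) {I : Type u} (X : I → Type u) : Type u :=
  ∀ i, X i

/-- The `κ`-box topology, generated by the canonical open sets. -/
instance BoxProduct.instTopologicalSpace (κ : Cardinal.{u}) {I : Type u} (X : I → Type u)
    [∀ i, TopologicalSpace (X i)] : TopologicalSpace (BoxProduct κ X) :=
  TopologicalSpace.generateFrom (canonicalOpenSets κ X)

/-- For infinite `κ` the canonical open sets form a base of the `κ`-box topology. -/
theorem isTopologicalBasis_canonicalOpenSets {κ : Cardinal.{u}} (hκ : ℵ₀ ≤ κ) {I : Type u}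
    (X : I → Type u) [∀ i, TopologicalSpace (X i)] :
    TopologicalSpace.IsTopologicalBasis (α := BoxProduct κ X) (canonicalOpenSets κ X) := by
  refine ⟨?_, ?_, rfl⟩
  · rintro _ ⟨U, hU, hUκ, rfl⟩ _ ⟨V, hV, hVκ, rfl⟩ x hx
    refine ⟨Set.univ.pi fun i => U i ∩ V i,
      ⟨fun i => U i ∩ V i, fun i => (hU i).inter (hV i), ?_, rfl⟩, ?_, ?_⟩
    · refine lt_of_le_of_lt ?_ (Cardinal.add_lt_of_lt hκ hUκ hVκ)
      refine le_trans (Cardinal.mk_le_mk_of_subset ?_) (Cardinal.mk_union_le _ _)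
      intro i hi
      by_contra h
      have hUi : U i = Set.univ := by_contra fun hne => h (Or.inl hne)
      have hVi : V i = Set.univ := by_contra fun hne => h (Or.inr hne)
      exact hi (show U i ∩ V i = Set.univ by rw [hUi, hVi, Set.inter_self])
    · rwa [Set.pi_inter_distrib]
    · rw [Set.pi_inter_distrib]
      exact fun _ h => h
  · refine Set.eq_univ_of_univ_subset
      (Set.subset_sUnion_of_mem ⟨fun _ => Set.univ, fun _ => isOpen_univ, ?_,
        (Set.pi_univ (Set.univ : Set I)).symm⟩)
    have h : {i : I | (Set.univ : Set (X i)) ≠ Set.univ} = ∅ := by simp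
    rw [h, Cardinal.mk_eq_zero]
    exact lt_of_lt_of_le Cardinal.aleph0_pos hκ

/-! Pass to pairwise disjoint boxes and enumerate each support by a set `L`. Disjoint boxes are
already disjoint in a coordinate that both restrict; colour a pair by the two positions of such a
coordinate. By Erdős–Rado, too many boxes give a `θ`-sequence of constant colour `(a, b)`. The
coordinate at position `a` of the first box is then at position `b` of every later one, so all later
pairs are disjoint in that single coordinate, against `S(X i) ≤ θ`
(`mk_le_of_pairwise_disjoint_boxes`). For (a) take `θ = α⁺` and `#L = α`. For (b) sort the boxes
into `κ` classes by support size and bound each class. -/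

/-- The elements before a given one in the initial ordinal of `θ` number fewer than `θ`. -/
theorem mk_Iio_toType_ord_lt (θ : Cardinal.{u}) (w : θ.ord.ToType) : #(Set.Iio w) < θ := by
  have h := Ordinal.card_typein (r := ((· < ·) : θ.ord.ToType → θ.ord.ToType → Prop)) w
  have h2 := Ordinal.typein_lt_self w
  rw [Cardinal.lt_ord] at h2
  exact lt_of_eq_of_lt h h2

/-- Every cardinal below `κ` is the size of an initial segment of the initial ordinal of `κ`. -/
theorem exists_mk_Iio_toType_ord_eq {κ c : Cardinal.{u}} (hc : c < κ) :
    ∃ w : κ.ord.ToType, #(Set.Iio w) = c := by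
  have hlt : c.ord < Ordinal.type ((· < ·) : κ.ord.ToType → κ.ord.ToType → Prop) := by
    rw [Ordinal.type_toType]
    exact Cardinal.ord_lt_ord.2 hc
  refine ⟨Ordinal.enum (α := κ.ord.ToType) (· < ·) ⟨c.ord, hlt⟩, ?_⟩
  have h := Ordinal.card_typein (r := ((· < ·) : κ.ord.ToType → κ.ord.ToType → Prop))
    (Ordinal.enum (α := κ.ord.ToType) (· < ·) ⟨c.ord, hlt⟩)
  rw [Ordinal.typein_enum, Cardinal.card_ord] at h
  exact h.symm

/-! ### End-homogeneous branches and the partition theorem -/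

section Partition

variable {W S C : Type u} [LinearOrder W] [WellFoundedLT W]

/-- The branch of `x` in the end-homogeneous tree of the colouring `col`: the next node is a new
point which receives from all earlier nodes the same colours as `x`. -/
noncomputable def endHomogeneousBranch (col : S → S → C) (x : S) : W → S :=
  (wellFounded_lt (α := W)).fix fun w ih =>
    @Classical.epsilon S ⟨x⟩ fun y =>
      ∀ v (h : v < w), y ≠ ih v h ∧ col (ih v h) y = col (ih v h) x

theorem endHomogeneousBranch_eq (col : S → S → C) (x : S) (w : W) :
    endHomogeneousBranch col x w = @Classical.epsilon S ⟨x⟩ fun y =>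
      ∀ v < w, y ≠ endHomogeneousBranch col x v ∧
        col (endHomogeneousBranch col x v) y = col (endHomogeneousBranch col x v) x :=
  WellFounded.fix_eq _ _ _

/-- A node of the branch of `x` is determined by the colours that `x` gets from earlier nodes. -/
theorem endHomogeneousBranch_congr (col : S → S → C) {x x' : S} (w : W)
    (h : ∀ v < w, col (endHomogeneousBranch col x v) x = col (endHomogeneousBranch col x' v) x') :
    endHomogeneousBranch col x w = endHomogeneousBranch col x' w := by
  induction w using WellFoundedLT.induction with
  | ind w ih =>
    have ih' : ∀ v < w, endHomogeneousBranch col x v = endHomogeneousBranch col x' v :=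
      fun v hv => ih v hv fun u hu => h u (hu.trans hv)
    rw [endHomogeneousBranch_eq, endHomogeneousBranch_eq]
    congr 1
    ext y
    refine forall₂_congr fun v hv => ?_
    rw [h v hv, ih' v hv]

/-- A point that is missed by its own branch realizes all conditions along the branch. -/
theorem endHomogeneousBranch_spec (col : S → S → C) {x : S}
    (hx : ∀ w : W, endHomogeneousBranch col x w ≠ x) {v w : W} (hvw : v < w) :
    endHomogeneousBranch col x w ≠ endHomogeneousBranch col x v ∧
      col (endHomogeneousBranch col x v) (endHomogeneousBranch col x w) =
        col (endHomogeneousBranch col x v) x := by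
  -- The point `x` itself is a candidate at every stage, so the choice succeeds.
  have h := Classical.epsilon_spec (p := fun y => ∀ v < w, y ≠ endHomogeneousBranch col x v ∧
    col (endHomogeneousBranch col x v) y = col (endHomogeneousBranch col x v) x)
    ⟨x, fun v _ => ⟨(hx v).symm, rfl⟩⟩
  rw [endHomogeneousBranch_eq col x w]
  exact h v hvw

end Partition

/-- A form of the Erdős–Rado theorem: a colouring of the ordered pairs from more than `μ` points
with fewer than `θ` colours is constant on the increasing pairs of some `θ`-sequence. -/
theorem exists_homogeneous_sequence {S C : Type u} {θ μ : Cardinal.{u}} (hθ : θ.IsRegular)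
    (hC : #C < θ) (hθμ : θ ≤ μ) (hμ : ∀ ν < θ, #C ^ ν ≤ μ) (hS : μ < #S) (col : S → S → C) :
    ∃ (T : Set θ.ord.ToType) (f : θ.ord.ToType → S) (c : C), #T = θ ∧
      ∀ t ∈ T, ∀ t' ∈ T, t < t' → f t ≠ f t' ∧ col (f t) (f t') = c := by
  obtain ⟨x, hx⟩ : ∃ x : S, ∀ w : θ.ord.ToType, endHomogeneousBranch col x w ≠ x := by
    by_contra! hcon
    choose w hw using hcon
    -- If every point lay on its own branch, its level and the colours below would determine it,
    -- leaving at most `θ * μ = μ` points.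
    let F : S → Σ w : θ.ord.ToType, (Set.Iio w → C) := fun x =>
      ⟨w x, fun v => col (endHomogeneousBranch col x v.1) x⟩
    have key : ∀ (x x' : S) (a b : θ.ord.ToType), a = b →
        endHomogeneousBranch col x a = x → endHomogeneousBranch col x' b = x' →
        HEq (fun v : Set.Iio a => col (endHomogeneousBranch col x v.1) x)
          (fun v : Set.Iio b => col (endHomogeneousBranch col x' v.1) x') → x = x' := by
      rintro x x' a _ rfl hxa hxb hF
      rw [← hxa, ← hxb]
      exact endHomogeneousBranch_congr col a fun v hv => congrFun (eq_of_heq hF) ⟨v, hv⟩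
    have hF : Function.Injective F := by
      intro x x' hxx'
      obtain ⟨h1, h2⟩ := Sigma.mk.inj_iff.1 hxx'
      exact key x x' _ _ h1 (hw x) (hw x') h2
    have hle : #S ≤ θ * μ := by
      refine (Cardinal.mk_le_of_injective hF).trans ?_
      rw [Cardinal.mk_sigma]
      refine (Cardinal.sum_le_sum _ (fun _ => μ) fun w => ?_).trans ?_
      · rw [← Cardinal.power_def]
        exact hμ _ (mk_Iio_toType_ord_lt θ w)
      · rw [Cardinal.sum_const', Cardinal.mk_toType, Cardinal.card_ord]
    rw [Cardinal.mul_eq_max hθ.aleph0_le (hθ.aleph0_le.trans hθμ), max_eq_right hθμ] at hle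
    exact absurd hS (not_lt.2 hle)
  have hW : #θ.ord.ToType = θ := by rw [Cardinal.mk_toType, Cardinal.card_ord]
  -- Along the branch the colour of a pair depends only on its earlier node, so regularity of `θ`
  -- makes it constant on `θ` nodes.
  obtain ⟨c, hc⟩ := Cardinal.infinite_pigeonhole
    (fun w : θ.ord.ToType => col (endHomogeneousBranch col x w) x)
    (by rw [hW]; exact hθ.aleph0_le) (by rw [hW, hθ.cof_ord]; exact hC)
  refine ⟨_, endHomogeneousBranch col x, c, hc.trans hW, ?_⟩
  intro t ht t' _ htt'
  obtain ⟨h1, h2⟩ := endHomogeneousBranch_spec col hx htt'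
  exact ⟨h1.symm, h2.trans ht⟩

/-! ### Cellular families and disjoint boxes -/

/-- Cellular families have fewer than `S(X)` members. -/
theorem IsCellular.mk_lt_souslinNumber {X : Type u} [TopologicalSpace X] {A : Set (Set X)}
    (hA : IsCellular A) : #A < souslinNumber X := by
  by_contra! h
  obtain ⟨B, hBA, hB⟩ := Cardinal.le_mk_iff_exists_subset.1 h
  exact csInf_mem (souslinNumber_set_nonempty X)
    ⟨B, ⟨fun U hU => hA.isOpen U (hBA hU), fun U hU => hA.nonempty U (hBA hU),
      hA.pairwiseDisjoint.subset hBA⟩, hB⟩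

/-- If all cellular families have at most `β` members, then `S(X) ≤ β⁺`. -/
theorem souslinNumber_le_succ {X : Type u} [TopologicalSpace X] {β : Cardinal.{u}}
    (h : ∀ A : Set (Set X), IsCellular A → #A ≤ β) : souslinNumber X ≤ Order.succ β := by
  refine csInf_le' ?_
  rintro ⟨A, hA, hAβ⟩
  have := h A hA
  rw [hAβ] at this
  exact absurd (Order.lt_succ β) (not_lt.2 this)

/-- An indexed family of pairwise disjoint nonempty open sets has fewer than `S(X)` members. -/
theorem mk_lt_souslinNumber_of_pairwise_disjoint {X T : Type u} [TopologicalSpace X]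
    (V : T → Set X) (ho : ∀ t, IsOpen (V t)) (hne : ∀ t, (V t).Nonempty)
    (hd : Pairwise (Function.onFun Disjoint V)) : #T < souslinNumber X := by
  have hinj : Function.Injective V := by
    intro s t hst
    by_contra hne'
    have h := hd hne'
    rw [Function.onFun, hst, disjoint_self] at h
    exact (hne t).ne_empty h
  rw [← Cardinal.mk_range_eq V hinj]
  refine IsCellular.mk_lt_souslinNumber ⟨?_, ?_, ?_⟩
  · rintro _ ⟨t, rfl⟩
    exact ho t
  · rintro _ ⟨t, rfl⟩
    exact hne t
  · rintro _ ⟨s, rfl⟩ _ ⟨t, rfl⟩ hst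
    exact hd fun h => hst (congrArg V h)

/-- Two disjoint boxes with nonempty factors are disjoint in a coordinate that restricts both. -/
theorem exists_disjoint_of_disjoint_pi {I : Type u} {X : I → Type u} {U V : ∀ i, Set (X i)}
    (hU : ∀ i, (U i).Nonempty) (hV : ∀ i, (V i).Nonempty)
    (h : Disjoint (Set.univ.pi U) (Set.univ.pi V)) :
    ∃ i, U i ≠ Set.univ ∧ V i ≠ Set.univ ∧ Disjoint (U i) (V i) := by
  obtain ⟨i, hi⟩ := Set.disjoint_univ_pi.1 h
  refine ⟨i, fun hu => ?_, fun hv => ?_, hi⟩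
  · rw [hu, Set.univ_disjoint] at hi
    exact (hV i).ne_empty hi
  · rw [hv, Set.disjoint_univ] at hi
    exact (hU i).ne_empty hi

/-- Pairwise disjoint open boxes restricting at most `#L` coordinates each number at most `μ`, if
no factor has a cellular family of size `θ` and `μ` is large enough for the partition theorem. -/
theorem mk_le_of_pairwise_disjoint_boxes {I : Type u} {X : I → Type u}
    [∀ i, TopologicalSpace (X i)] {S L : Type u} {θ μ : Cardinal.{u}} (hθ : θ.IsRegular)
    (hX : ∀ i, souslinNumber (X i) ≤ θ) (hL : #L < θ) (hθμ : θ ≤ μ)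
    (hμ : ∀ ν < θ, (#L * #L) ^ ν ≤ μ) (U : S → ∀ i, Set (X i)) (ho : ∀ s i, IsOpen (U s i))
    (hne : ∀ s i, (U s i).Nonempty) (hsupp : ∀ s, #{i : I | U s i ≠ Set.univ} ≤ #L)
    (hd : ∀ s t, s ≠ t → Disjoint (Set.univ.pi (U s)) (Set.univ.pi (U t))) : #S ≤ μ := by
  by_contra! hS
  have hcoord : ∀ s t, s ≠ t →
      ∃ i, U s i ≠ Set.univ ∧ U t i ≠ Set.univ ∧ Disjoint (U s i) (U t i) :=
    fun s t hst => exists_disjoint_of_disjoint_pi (hne s) (hne t) (hd s t hst)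
  have e := fun s => Classical.choice ((Cardinal.le_def _ _).1 (hsupp s))
  -- Needed only to have an element of `L` as a dummy colour on the diagonal.
  obtain ⟨s₀, t₀, hst₀⟩ : ∃ s t : S, s ≠ t := by
    have h1 : 1 < #S := (Cardinal.one_lt_aleph0.trans_le (hθ.aleph0_le.trans hθμ)).trans hS
    exact (Cardinal.one_lt_iff_nontrivial.1 h1).exists_pair_ne
  obtain ⟨i₀, hi₀, -⟩ := hcoord s₀ t₀ hst₀
  have hcol : ∀ s t, ∃ c : L × L, s ≠ t → ∃ (i : I) (hs : U s i ≠ Set.univ)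
      (ht : U t i ≠ Set.univ), Disjoint (U s i) (U t i) ∧ e s ⟨i, hs⟩ = c.1 ∧
        e t ⟨i, ht⟩ = c.2 := by
    intro s t
    by_cases hst : s = t
    · exact ⟨(e s₀ ⟨i₀, hi₀⟩, e s₀ ⟨i₀, hi₀⟩), fun h => absurd hst h⟩
    · obtain ⟨i, hs, ht, hdis⟩ := hcoord s t hst
      exact ⟨(e s ⟨i, hs⟩, e t ⟨i, ht⟩), fun _ => ⟨i, hs, ht, hdis, rfl, rfl⟩⟩
  choose col hcol using hcol
  have hC : #(L × L) = #L * #L := by simp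
  obtain ⟨T, f, c, hT, hom⟩ := exists_homogeneous_sequence hθ
    (by rw [hC]; exact Cardinal.mul_lt_of_lt hθ.aleph0_le hL hL) hθμ
    (by rw [hC]; exact hμ) hS col
  have hpair : ∀ t ∈ T, ∀ t' ∈ T, t < t' → ∃ (i : I) (hs : U (f t) i ≠ Set.univ)
      (ht : U (f t') i ≠ Set.univ), Disjoint (U (f t) i) (U (f t') i) ∧
        e (f t) ⟨i, hs⟩ = c.1 ∧ e (f t') ⟨i, ht⟩ = c.2 := by
    intro t ht t' ht' htt'
    obtain ⟨h1, h2⟩ := hom t ht t' ht' htt'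
    have h3 := hcol (f t) (f t') h1
    rw [h2] at h3
    exact h3
  have hTinf : ℵ₀ ≤ #T := hθ.aleph0_le.trans_eq hT.symm
  have : Infinite T := Cardinal.infinite_iff.2 hTinf
  obtain ⟨m, hmT, hmin⟩ : ∃ m ∈ T, ∀ t ∈ T, m ≤ t := by
    have hTne : T.Nonempty := Set.nonempty_coe_sort.1 inferInstance
    exact ⟨wellFounded_lt.min T hTne, wellFounded_lt.min_mem T hTne,
      fun t ht => not_lt.1 (wellFounded_lt.not_lt_min T ht)⟩
  have hT' : #(T \ {m} : Set θ.ord.ToType) = θ := by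
    refine Cardinal.eq_of_add_eq_add_right (b := 1) ?_ Cardinal.one_lt_aleph0
    have h := Cardinal.mk_sdiff_add_mk (Set.singleton_subset_iff.2 hmT)
    rw [Cardinal.mk_singleton] at h
    rw [Cardinal.add_one_eq hθ.aleph0_le, h, hT]
  have hlt : ∀ t ∈ T \ {m}, m < t := fun t ht =>
    lt_of_le_of_ne (hmin t ht.1) fun h => ht.2 h.symm
  obtain ⟨t₁, ht₁⟩ : (T \ {m}).Nonempty := by
    rw [← Set.nonempty_coe_sort, ← Cardinal.mk_ne_zero_iff, hT']
    exact hθ.ne_zero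
  obtain ⟨i, hmi, -, -, hi, -⟩ := hpair m hmT t₁ ht₁.1 (hlt t₁ ht₁)
  have hlate : ∀ t ∈ T \ {m}, ∃ ht : U (f t) i ≠ Set.univ, e (f t) ⟨i, ht⟩ = c.2 := by
    intro t ht
    obtain ⟨j, hmj, htj, -, hj, hj'⟩ := hpair m hmT t ht.1 (hlt t ht)
    obtain rfl : i = j := congrArg Subtype.val ((e (f m)).injective (hi.trans hj.symm))
    exact ⟨htj, hj'⟩
  have hdis : ∀ s ∈ T \ {m}, ∀ t ∈ T \ {m}, s < t → Disjoint (U (f s) i) (U (f t) i) := by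
    intro s hs t ht hst
    -- Both `i` and `j` sit at position `c.2` in the support of the later box.
    obtain ⟨j, -, htj, hd', -, hj'⟩ := hpair s hs.1 t ht.1 hst
    obtain ⟨hti, hi'⟩ := hlate t ht
    obtain rfl : i = j := congrArg Subtype.val ((e (f t)).injective (hi'.trans hj'.symm))
    exact hd'
  refine absurd (hX i) (not_le.2 ?_)
  rw [← hT']
  refine mk_lt_souslinNumber_of_pairwise_disjoint
    (fun t : (T \ {m} : Set θ.ord.ToType) => U (f t) i) (fun t => ho _ _) (fun t => hne _ _) ?_
  intro s t hst
  rcases lt_or_gt_of_ne (fun h => hst (Subtype.ext h) : s.1 ≠ t.1) with h | h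
  · exact hdis s s.2 t t.2 h
  · exact (hdis t t.2 s s.2 h).symm

/-- A bound on the size of families of pairwise disjoint nonempty canonical open sets bounds the
Souslin number of the `κ`-box product. -/
theorem souslinNumber_boxProduct_le {κ β : Cardinal.{u}} (hκ : ℵ₀ ≤ κ) {I : Type u}
    {X : I → Type u} [∀ i, TopologicalSpace (X i)]
    (h : ∀ (S : Type u) (U : S → ∀ i, Set (X i)), (∀ s i, IsOpen (U s i)) →
      (∀ s i, (U s i).Nonempty) → (∀ s, #{i : I | U s i ≠ Set.univ} < κ) →
      (∀ s t, s ≠ t → Disjoint (Set.univ.pi (U s)) (Set.univ.pi (U t))) → #S ≤ β) :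
    souslinNumber (BoxProduct κ X) ≤ Order.succ β := by
  refine souslinNumber_le_succ fun A hA => ?_
  have hbox : ∀ s : A, ∃ U : ∀ i, Set (X i), (∀ i, IsOpen (U i)) ∧ (∀ i, (U i).Nonempty) ∧
      #{i : I | U i ≠ Set.univ} < κ ∧ Set.univ.pi U ⊆ (s.1 : Set (∀ i, X i)) := by
    rintro ⟨O, hO⟩
    obtain ⟨x, hx⟩ := hA.nonempty O hO
    obtain ⟨_, ⟨U, hU, hUκ, rfl⟩, hxU, hUO⟩ :=
      (isTopologicalBasis_canonicalOpenSets hκ X).exists_subset_of_mem_open hx (hA.isOpen O hO)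
    exact ⟨U, hU, fun i => ⟨x i, hxU i trivial⟩, hUκ, hUO⟩
  choose U hU hUne hUκ hUA using hbox
  refine h A U hU hUne hUκ fun s t hst => ?_
  exact (hA.pairwiseDisjoint s.2 t.2 fun h => hst (Subtype.ext h)).mono (hUA s) (hUA t)

/-! ### Cardinal arithmetic and the theorem -/

theorem le_powerlt_of_two_le {α κ : Cardinal.{u}} (hα : 2 ≤ α) : κ ≤ α ^< κ :=
  le_of_forall_lt fun _ hx =>
    ((Cardinal.cantor _).trans_le (Cardinal.power_le_power_right hα)).trans_le
      (Cardinal.le_powerlt α hx)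

theorem theorem4p36 (α κ : Cardinal.{u}) (hα : 2 ≤ α) (hκ : ℵ₀ ≤ κ)
    (I : Type u) (X : I → Type u) [∀ i, TopologicalSpace (X i)] [∀ i, Nonempty (X i)]
    (hX : ∀ i, souslinNumber (X i) ≤ Order.succ α) :
    (κ ≤ Order.succ α →
      souslinNumber (BoxProduct κ X) ≤ Order.succ (2 ^ α)) ∧
    (Order.succ α ≤ κ →
      souslinNumber (BoxProduct κ X) ≤ Order.succ ((α ^< κ) ^< κ)) := by
  have two_power : ∀ {c ν : Cardinal.{u}}, ℵ₀ ≤ c → ν < Order.succ c →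
      (c * c) ^ ν ≤ 2 ^ c := by
    intro c ν hc hν
    rw [Cardinal.mul_eq_self hc, ← Cardinal.power_self_eq hc]
    exact Cardinal.power_le_power_left (Cardinal.aleph0_pos.trans_le hc).ne'
      (Order.lt_succ_iff.1 hν)
  constructor
  · intro hκα
    have hα' : ℵ₀ ≤ α := by
      -- A finite `α` would have a finite successor, below `κ`.
      by_contra! h
      exact absurd (hκ.trans hκα) (not_le.2 (Cardinal.isSuccLimit_aleph0.succ_lt h))
    refine souslinNumber_boxProduct_le hκ fun S U ho hne hsupp hd => ?_
    refine mk_le_of_pairwise_disjoint_boxes (L := α.out) (Cardinal.isRegular_succ hα') hX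
      ?_ (Order.succ_le_of_lt (Cardinal.cantor α)) ?_ U ho hne ?_ hd
    · simp
    · intro ν hν
      rw [Cardinal.mk_out]
      exact two_power hα' hν
    · intro s
      rw [Cardinal.mk_out]
      exact Order.lt_succ_iff.1 ((hsupp s).trans_le hκα)
  · intro hακ
    have hα0 : 2 ≤ α ^< κ := by
      exact (Cardinal.natCast_lt_aleph0 (n := 2)).le.trans (hκ.trans (le_powerlt_of_two_le hα))
    have hκβ : κ ≤ (α ^< κ) ^< κ := le_powerlt_of_two_le hα0
    have hγβ : α ^< κ ≤ (α ^< κ) ^< κ := by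
      simpa using Cardinal.le_powerlt (α ^< κ) (Cardinal.one_lt_aleph0.trans_le hκ)
    have hβ : ℵ₀ ≤ (α ^< κ) ^< κ := hκ.trans hκβ
    refine souslinNumber_boxProduct_le hκ fun S U ho hne hsupp hd => ?_
    choose w hw using fun s => exists_mk_Iio_toType_ord_eq (hsupp s)
    have hfib : ∀ v : κ.ord.ToType, #(w ⁻¹' {v}) ≤ (α ^< κ) ^< κ := by
      intro v
      have hv := mk_Iio_toType_ord_lt κ v
      have hsupp' : ∀ s : w ⁻¹' {v}, #{i : I | U s i ≠ Set.univ} = #(Set.Iio v) := by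
        rintro ⟨s, rfl⟩
        exact (hw s).symm
      have hd' : ∀ s t : w ⁻¹' {v}, s ≠ t →
          Disjoint (Set.univ.pi (U s)) (Set.univ.pi (U t)) :=
        fun s t hst => hd s t fun h => hst (Subtype.ext h)
      -- For `κ = ℵ₀` no infinite cardinal lies below `κ`, so `θ = ℵ₀` replaces a successor; the
      -- powers are then finite.
      rcases hκ.eq_or_lt with rfl | hκ'
      · refine mk_le_of_pairwise_disjoint_boxes (L := Set.Iio v) Cardinal.isRegular_aleph0
          (fun i => (hX i).trans hακ) hv hβ ?_ (fun s => U s) (fun s => ho s) (fun s => hne s)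
          (fun s => (hsupp' s).le) hd'
        intro ν hν
        exact (Cardinal.power_lt_aleph0 (Cardinal.mul_lt_aleph0 hv hv) hν).le.trans hβ
      · have hακ' : α < κ := Order.succ_le_iff.1 hακ
        -- Infinite makes `c⁺` regular, `α ≤ c` transfers `hX`, the last term covers the supports,
        -- and `c < κ` keeps `2 ^ c` below `α ^< κ`.
        obtain ⟨c, hc⟩ : ∃ c, c = max ℵ₀ (max α #(Set.Iio v)) := ⟨_, rfl⟩
        have hcκ : c < κ := hc ▸ max_lt hκ' (max_lt hακ' hv)
        have hc0 : ℵ₀ ≤ c := hc ▸ le_max_left _ _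
        have hαc : α ≤ c := hc ▸ (le_max_left _ _).trans (le_max_right _ _)
        have hvc : #(Set.Iio v) ≤ c := hc ▸ (le_max_right _ _).trans (le_max_right _ _)
        have hle : #(w ⁻¹' {v}) ≤ 2 ^ c := by
          refine mk_le_of_pairwise_disjoint_boxes (L := c.out) (Cardinal.isRegular_succ hc0)
            (fun i => (hX i).trans (Order.succ_le_succ hαc)) ?_
            (Order.succ_le_of_lt (Cardinal.cantor c)) ?_ (fun s => U s) (fun s => ho s)
            (fun s => hne s) ?_ hd'
          · simp
          · intro ν hν
            rw [Cardinal.mk_out]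
            exact two_power hc0 hν
          · intro s
            rw [Cardinal.mk_out, hsupp' s]
            exact hvc
        exact hle.trans ((Cardinal.power_le_power_right hα).trans
          ((Cardinal.le_powerlt α hcκ).trans hγβ))
    refine (Cardinal.mk_le_mk_mul_of_mk_preimage_le w hfib).trans ?_
    rw [Cardinal.mk_toType, Cardinal.card_ord, Cardinal.mul_eq_max hκ hβ, max_eq_right hκβ]
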